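/- A flat $n$-torus is a quotient $T=\mathbb{R}^n/\mathcal{L}$ of Euclidean space by a lattice $\mathcal{L}$ of full rank, with the flat Riemannian metric induced by the standard inner product. Write $\mathcal{E}(T)$ for its eigenvalue set, i.e. the set of eigenvalues of the Laplace--Beltrami operator $\Delta=-\operatorname{div}\operatorname{grad}$ on smooth functions on $T$, ignoring multiplicities, and $\lambda_1(T)$ for the lowest non-zero eigenvalue. Given a positive integer $n$ and positive real numbers $\lambda$ and $v$, there exists a constant $A>1$, depending only on $n$ and on $\lambda^{n/2}v$, such that for any finite subset $E$ of the interval $[\lambda,A\lambda]$ there exist, up to isometry, at most finitely many flat $n$-tori $T$ satisfying the following conditions: (1) $\lambda_1(T)\ge\lambda$; (2) $\operatorname{vol}(T)\ge v$; (3) $\mathcal{E}(T)\cap[\lambda,A\lambda]\subset E$. -/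

import Mathlib

noncomputable section

open scoped ContDiff

/-- A flat `n`-torus, presented as the quotient of Euclidean `ℝⁿ` by a lattice of full rank. -/
structure FlatTorus (n : ℕ) where
  /-- The lattice `L` of translations. -/
  lattice : Submodule ℤ (EuclideanSpace ℝ (Fin n))
  discrete : DiscreteTopology lattice
  fullRank : IsZLattice ℝ lattice

namespace FlatTorus

variable {n : ℕ}

/-- The underlying space `ℝⁿ / L`. It carries the quotient metric, in which the distance between
the classes of `x` and `y` is the infimum of `‖x - y + l‖` over `l ∈ L`: this is the distance
of the Riemannian metric for which the projection from `ℝⁿ` is a local isometry. -/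
abbrev Carrier (T : FlatTorus n) : Type :=
  EuclideanSpace ℝ (Fin n) ⧸ T.lattice.toAddSubgroup

/-- The projection `ℝⁿ → ℝⁿ / L`, a Riemannian covering. -/
def proj (T : FlatTorus n) (x : EuclideanSpace ℝ (Fin n)) : T.Carrier :=
  QuotientAddGroup.mk x

/-- A function on the torus is smooth when its lift to `ℝⁿ` is (the projection being a local
diffeomorphism). -/
def SmoothFun (T : FlatTorus n) (f : T.Carrier → ℝ) : Prop :=
  ContDiff ℝ ∞ fun x => f (T.proj x)

/-- `mu` is an eigenvalue of the (positive) Laplace-Beltrami operator: some smooth function `f` on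
the torus, not identically zero, solves `-div grad f = mu f`. As the projection is a local
isometry, the Laplace-Beltrami operator is the Euclidean one on lifts. -/
def IsEigenvalue (T : FlatTorus n) (mu : ℝ) : Prop :=
  ∃ f : T.Carrier → ℝ, f ≠ 0 ∧ T.SmoothFun f ∧
    ∀ x, -(Laplacian.laplacian (fun y => f (T.proj y)) x) = mu * f (T.proj x)

/-- The set of Laplace eigenvalues, ignoring multiplicities. -/
def eigenvalueSet (T : FlatTorus n) : Set ℝ :=
  {mu | T.IsEigenvalue mu}

/-- The fundamental tone: the lowest nonzero eigenvalue. -/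
def fundamentalTone (T : FlatTorus n) : ℝ :=
  sInf {mu | mu ∈ T.eigenvalueSet ∧ mu ≠ 0}

/-- The Riemannian volume: the Lebesgue measure of a fundamental domain of the lattice. -/
def vol (T : FlatTorus n) : ℝ :=
  ZLattice.covolume T.lattice

/-- Two flat tori are isometric. -/
def isometrySetoid (n : ℕ) : Setoid (FlatTorus n) where
  r T T' := Nonempty (T.Carrier ≃ᵢ T'.Carrier)
  iseqv :=
    { refl := fun T => ⟨IsometryEquiv.refl T.Carrier⟩
      symm := fun ⟨e⟩ => ⟨e.symm⟩
      trans := fun ⟨e⟩ ⟨e'⟩ => ⟨e.trans e'⟩ }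

/-- The isometry class of a flat torus. -/
def isometryClass (T : FlatTorus n) : Quotient (isometrySetoid n) :=
  Quotient.mk (isometrySetoid n) T

end FlatTorus

end

open Module MeasureTheory Metric

/-! Each `ξ` in the dual lattice gives the eigenvalue `(2π‖ξ‖)²`. Hence condition (1) bounds the
nonzero dual vectors below by `m = √λ/(2π)`, while condition (2) bounds the dual covolume by `1/v`.
A packing argument then bounds the covering radius by `m * q`, so vectors of length at most `R = m *
(2q + 1)` generate the dual lattice, and separation bounds their number.

Generators and their pairwise sums have length at most `2R`, and `A` is chosen so that their
eigenvalues fall in the window. By (3) their norms take finitely many values; polarization leaves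
finitely many Gram matrices. A Gram matrix determines the dual lattice, hence the torus, up to
isometry. -/

/-! ### Geometry of numbers -/

/-- From a point far from the lattice to its nearest lattice point runs a segment carrying many
balls of radius `m / 2`. These are disjoint modulo `M`, so their total volume cannot exceed that of
`F`. -/
theorem IsAddFundamentalDomain.exists_mem_norm_sub_le {E : Type*} [NormedAddCommGroup E]
    [NormedSpace ℝ E] [FiniteDimensional ℝ E] [MeasurableSpace E] [BorelSpace E]
    {μ : Measure E} [μ.IsAddHaarMeasure] {M : Submodule ℤ E} [DiscreteTopology M] [Countable M]
    {F : Set E} (hF : IsAddFundamentalDomain M F μ) {m q : ℝ} (hm : 0 < m) (hq : 0 ≤ q)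
    (hmin : ∀ ξ ∈ M, ξ ≠ 0 → m ≤ ‖ξ‖)
    (hvol : μ F ≤ ENNReal.ofReal q * μ (ball 0 (m / 2))) (x : E) :
    ∃ ξ ∈ M, ‖x - ξ‖ ≤ m * q := by
  have : Countable M.toAddSubgroup := ‹Countable M›
  have : DiscreteTopology M.toAddSubgroup := ‹DiscreteTopology M›
  have hclosed : IsClosed (M : Set E) := AddSubgroup.isClosed_of_discrete (H := M.toAddSubgroup)
  have : ProperSpace E := FiniteDimensional.proper_real E
  obtain ⟨y, hy, hxy⟩ := hclosed.exists_infDist_eq_dist ⟨0, M.zero_mem⟩ x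
  refine ⟨y, hy, ?_⟩
  by_contra! hlt
  set u := x - y with hu
  have hd : 0 < ‖u‖ := (mul_nonneg hm.le hq).trans_lt hlt
  have hnear : ∀ ζ ∈ M, ‖u‖ ≤ ‖u + ζ‖ := fun ζ hζ => by
    have h := infDist_le_dist_of_mem (x := x) (M.sub_mem hy hζ)
    rw [hxy, dist_eq_norm, dist_eq_norm] at h
    rwa [← sub_add] at h
  -- The `K + 1` centres lie at spacing `m` from `0` towards `u`; `‖u‖ > m * q` forces `K + 1 > q`.
  set K := ⌊‖u‖ / m⌋₊
  have hK : ∀ k < K + 1, k * m ≤ ‖u‖ := fun k hk => by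
    have h1 : (K : ℝ) ≤ ‖u‖ / m := Nat.floor_le (by positivity)
    have h2 : (k : ℝ) ≤ K := by exact_mod_cast Nat.lt_succ_iff.mp hk
    exact (le_div_iff₀ hm).mp (h2.trans h1)
  set p : ℕ → E := fun k => (k * m / ‖u‖) • u with hp
  have hpn : ∀ k, ‖p k‖ = k * m := fun k => by
    rw [hp, norm_smul, Real.norm_of_nonneg (by positivity)]
    field_simp
  have hpu : ∀ k < K + 1, ‖u - p k‖ = ‖u‖ - k * m := fun k hk => by
    have h : u - p k = (1 - k * m / ‖u‖) • u := by rw [sub_smul, one_smul]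
    have h1 : k * m / ‖u‖ ≤ 1 := (div_le_one hd).mpr (hK k hk)
    rw [h, norm_smul, Real.norm_of_nonneg (by linarith)]
    field_simp
  -- Going from `u + ζ` to `p k + ζ`, then `p j`, then `0` costs less than `‖u‖ + (j + 1 - k) * m`,
  -- while `0` is a lattice point nearest to `u`.
  have hsep : ∀ ζ ∈ M, ∀ k < K + 1, ∀ j, ‖p k + ζ - p j‖ < m → k ≤ j := fun ζ hζ k hk j h => by
    have h1 : ‖u + ζ‖ ≤ ‖u - p k‖ + (‖p k + ζ - p j‖ + ‖p j‖) := by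
      calc ‖u + ζ‖ = ‖(u - p k) + ((p k + ζ - p j) + p j)‖ := by congr 1; abel
        _ ≤ _ := (norm_add_le _ _).trans (by gcongr; exact norm_add_le _ _)
    have h2 := hnear ζ hζ
    rw [hpu k hk, hpn] at h1
    have h3 : (k : ℝ) * m < (j + 1 : ℝ) * m := by linarith
    have h4 : (k : ℝ) < j + 1 := lt_of_mul_lt_mul_right h3 hm.le
    exact Nat.lt_succ_iff.mp (by exact_mod_cast h4)
  have hmeet : ∀ ζ ∈ M, ∀ k < K + 1, ∀ j < K + 1, ‖p k + ζ - p j‖ < m → k = j ∧ ζ = 0 := by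
    intro ζ hζ k hk j hj h
    have h' : ‖p j + -ζ - p k‖ < m := by
      rw [← norm_neg, show -(p j + -ζ - p k) = p k + ζ - p j by abel]
      exact h
    have hkj : k = j := le_antisymm (hsep ζ hζ k hk j h) (hsep (-ζ) (M.neg_mem hζ) j hj k h')
    subst hkj
    refine ⟨rfl, by_contra fun h0 => ?_⟩
    rw [add_sub_cancel_left] at h
    exact absurd (hmin ζ hζ h0) (not_le.mpr h)
  set s : Set E := ⋃ k ∈ Finset.range (K + 1), ball (p k) (m / 2)
  have hs : μ s = (K + 1 : ℕ) * μ (ball 0 (m / 2)) := by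
    rw [measure_biUnion_finset _ fun _ _ => measurableSet_ball]
    · simp [Measure.addHaar_ball_center]
    · intro k hk j hj hkj
      rw [Function.onFun, Set.disjoint_left]
      intro a ha hb
      rw [Finset.coe_range, Set.mem_Iio] at hk hj
      refine hkj (hmeet 0 M.zero_mem k hk j hj ?_).1
      rw [add_zero, ← dist_eq_norm]
      rw [mem_ball] at ha hb
      linarith [dist_triangle_left (p k) (p j) a]
  have hKq : q < (K + 1 : ℕ) := by
    have h1 : q < ‖u‖ / m := (lt_div_iff₀ hm).mpr (by linarith)
    exact h1.trans (by exact_mod_cast Nat.lt_floor_add_one (‖u‖ / m))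
  have hFs : μ F < μ s := by
    refine hvol.trans_lt ?_
    rw [hs]
    refine ENNReal.mul_lt_mul_left (measure_ball_pos _ _ (by positivity)).ne'
      measure_ball_lt_top.ne ?_
    rw [← ENNReal.ofReal_natCast]
    exact (ENNReal.ofReal_lt_ofReal_iff (hq.trans_lt hKq)).mpr hKq
  have hsm : MeasurableSet s := Finset.measurableSet_biUnion _ fun _ _ => measurableSet_ball
  -- Blichfeldt's principle: a set larger than a fundamental domain meets one of its translates.
  obtain ⟨ξ, η, hne, hdis⟩ :=
    exists_pair_mem_lattice_not_disjoint_vadd (L := M.toAddSubgroup) hF hsm.nullMeasurableSet hFs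
  obtain ⟨z, ⟨a, ha, rfl⟩, ⟨b, hb, hab⟩⟩ := Set.not_disjoint_iff.mp hdis
  simp only [s, Set.mem_iUnion, Finset.mem_range] at ha hb
  obtain ⟨k, hk, ha⟩ := ha
  obtain ⟨j, hj, hb⟩ := hb
  replace hab : (η : E) + b = ξ + a := hab
  have h := (hmeet (ξ - η) (M.sub_mem ξ.2 η.2) k hk j hj ?_).2
  · exact hne (Subtype.ext (sub_eq_zero.mp h))
  · rw [mem_ball, dist_eq_norm] at ha hb
    calc ‖p k + ((ξ : E) - η) - p j‖ = ‖(b - p j) - (a - p k)‖ := by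
          congr 1
          rw [eq_sub_of_add_eq' hab]; abel
      _ ≤ ‖b - p j‖ + ‖a - p k‖ := norm_sub_le _ _
      _ < m := by linarith

/-- Cut the segment from `0` to `ξ` into steps of length at most `ε` and round each node to the
lattice: consecutive roundings differ by at most `2 * ρ + ε`. -/
theorem Submodule.span_int_setOf_norm_le_eq {E : Type*} [NormedAddCommGroup E] [NormedSpace ℝ E]
    {M : Submodule ℤ E} {ρ ε : ℝ} (hε : 0 < ε) (hcov : ∀ x : E, ∃ ξ ∈ M, ‖x - ξ‖ ≤ ρ) :
    Submodule.span ℤ {ξ | ξ ∈ M ∧ ‖ξ‖ ≤ 2 * ρ + ε} = M := by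
  refine le_antisymm (Submodule.span_le.mpr fun ξ h => h.1) fun ξ hξ => ?_
  choose g hgM hg using hcov
  have hρ : 0 ≤ ρ := (norm_nonneg _).trans (hg 0)
  obtain ⟨N, hN⟩ := exists_nat_gt (‖ξ‖ / ε)
  have hN0 : (0 : ℝ) < N := lt_of_le_of_lt (by positivity) hN
  have hstep : ‖ξ‖ / N ≤ ε := by
    rw [div_lt_iff₀ hε] at hN
    rw [div_le_iff₀ hN0]; linarith
  have hmem : ∀ k : ℕ, g ((k / N : ℝ) • ξ) ∈
      Submodule.span ℤ {ξ | ξ ∈ M ∧ ‖ξ‖ ≤ 2 * ρ + ε} := by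
    intro k
    induction k with
    | zero =>
      refine Submodule.subset_span ⟨hgM _, ?_⟩
      have := hg 0
      rw [zero_sub, norm_neg] at this
      simp only [Nat.cast_zero, zero_div, zero_smul]
      linarith
    | succ k ih =>
      rw [← sub_add_cancel (g (((k + 1 : ℕ) / N : ℝ) • ξ)) (g ((k / N : ℝ) • ξ))]
      refine Submodule.add_mem _ (Submodule.subset_span ⟨M.sub_mem (hgM _) (hgM _), ?_⟩) ih
      set a := (k / N : ℝ) • ξ
      set b := ((k + 1 : ℕ) / N : ℝ) • ξ with hb
      have hba : ‖b - a‖ = ‖ξ‖ / N := by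
        rw [hb, ← sub_smul, norm_smul, Nat.cast_succ, ← sub_div, add_sub_cancel_left,
          Real.norm_of_nonneg (by positivity)]
        ring
      calc ‖g b - g a‖ = ‖(b - a) + (a - g a) - (b - g b)‖ := by congr 1; abel
        _ ≤ ‖b - a‖ + ‖a - g a‖ + ‖b - g b‖ :=
          (norm_sub_le _ _).trans (by gcongr; exact norm_add_le _ _)
        _ ≤ 2 * ρ + ε := by linarith [hg a, hg b]
  have hlast := hmem N
  rw [div_self hN0.ne', one_smul] at hlast
  rw [← sub_add_cancel ξ (g ξ)]
  exact Submodule.add_mem _ (Submodule.subset_span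
    ⟨M.sub_mem hξ (hgM _), (hg ξ).trans (by linarith)⟩) hlast

/-- One finite index type parametrizes all `m`-separated subsets of a bounded ball. -/
theorem exists_finset_forall_separated_eq_range {E : Type*} [NormedAddCommGroup E]
    [ProperSpace E] (R : ℝ) {m : ℝ} (hm : 0 < m) :
    ∃ t : Finset E, ∀ S : Set E, S.Nonempty → S ⊆ closedBall 0 R →
      (∀ x ∈ S, ∀ y ∈ S, x ≠ y → m ≤ dist x y) → ∃ f : t → E, Set.range f = S := by
  obtain ⟨t, -, ht, hcov⟩ := finite_approx_of_totallyBounded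
    (isCompact_closedBall (0 : E) R).totallyBounded (m / 2) (by positivity)
  refine ⟨ht.toFinset, fun S ⟨a, ha⟩ hSR hsep => ?_⟩
  classical
  -- A ball of radius `m / 2` holds at most one point of `S`; the default `a` keeps the range inside
  -- `S` when it holds none.
  let f : ht.toFinset → E := fun y =>
    if h : ∃ x ∈ S, x ∈ ball (y : E) (m / 2) then h.choose else a
  refine ⟨f, Set.Subset.antisymm ?_ fun x hx => ?_⟩
  · rintro _ ⟨y, rfl⟩
    by_cases h : ∃ x ∈ S, x ∈ ball (y : E) (m / 2)
    · simpa only [f, dif_pos h] using h.choose_spec.1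
    · simpa only [f, dif_neg h] using ha
  · obtain ⟨y, hy, hxy⟩ := Set.mem_iUnion₂.mp (hcov (hSR hx))
    have h : ∃ x ∈ S, x ∈ ball y (m / 2) := ⟨x, hx, hxy⟩
    refine ⟨⟨y, ht.mem_toFinset.mpr hy⟩, ?_⟩
    simp only [f, dif_pos h]
    by_contra hne
    have h1 := hsep _ h.choose_spec.1 x hx hne
    have h2 := h.choose_spec.2
    rw [mem_ball] at h2 hxy
    linarith [dist_triangle_right h.choose x y]

/-- Families with the same Gram matrix are congruent. -/
theorem exists_linearIsometryEquiv_of_inner_eq {ι E : Type*} [NormedAddCommGroup E]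
    [InnerProductSpace ℝ E] [FiniteDimensional ℝ E] {v w : ι → E}
    (h : ∀ i j, inner ℝ (v i) (v j) = inner ℝ (w i) (w j)) :
    ∃ φ : E ≃ₗᵢ[ℝ] E, ∀ i, φ (v i) = w i := by
  let V := Finsupp.linearCombination ℝ v
  let W := Finsupp.linearCombination ℝ w
  have hVW : ∀ c, ‖W c‖ = ‖V c‖ := fun c => by
    have : inner ℝ (W c) (W c) = inner ℝ (V c) (V c) := by
      simp only [V, W, Finsupp.linearCombination_apply, Finsupp.sum_inner, Finsupp.inner_sum,
        inner_smul_left, inner_smul_right, h]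
    rw [norm_eq_sqrt_real_inner, this, ← norm_eq_sqrt_real_inner]
  obtain ⟨g, hg⟩ := V.rangeRestrict.exists_rightInverse_of_surjective V.range_rangeRestrict
  have hVg : ∀ y, V (g y) = y := fun y => congrArg Subtype.val (LinearMap.congr_fun hg y)
  let φ₀ : LinearMap.range V →ₗᵢ[ℝ] E := ⟨W ∘ₗ g, fun y => by
    rw [LinearMap.comp_apply, hVW, hVg, Submodule.coe_norm]⟩
  refine ⟨φ₀.extend.toLinearIsometryEquiv rfl, fun i => ?_⟩
  have hvi : V (Finsupp.single i 1) = v i := by simp [V]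
  let y : LinearMap.range V := ⟨v i, _, hvi⟩
  have hy : φ₀.extend (v i) = φ₀ y := φ₀.extend_apply y
  -- `V` and `W` have the same kernel, so the choice of coefficients `g y` does not matter.
  have hz : ‖W (g y - Finsupp.single i 1)‖ = 0 := by
    rw [hVW, map_sub, hVg, hvi, sub_self, norm_zero]
  rw [norm_eq_zero, map_sub, sub_eq_zero] at hz
  rw [LinearIsometry.coe_toLinearIsometryEquiv, hy]
  exact hz.trans (by simp [W])

/-! ### Plane waves and dual bases -/

theorem laplacian_cos_inner {E : Type*} [NormedAddCommGroup E] [InnerProductSpace ℝ E]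
    [FiniteDimensional ℝ E] (a x : E) :
    Laplacian.laplacian (fun y => Real.cos (inner ℝ a y)) x =
      -(‖a‖ ^ 2 * Real.cos (inner ℝ a x)) := by
  have h1 : fderiv ℝ (fun y => Real.cos (inner ℝ a y)) =
      fun y => -Real.sin (inner ℝ a y) • innerSL ℝ a := by
    ext1 y
    exact ((innerSL ℝ a).hasFDerivAt (x := y)).cos.fderiv
  have h2 : fderiv ℝ (fun y => -Real.sin (inner ℝ a y) • innerSL ℝ a) x =
      (-(Real.cos (inner ℝ a x) • innerSL ℝ a)).smulRight (innerSL ℝ a) :=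
    (((innerSL ℝ a).hasFDerivAt (x := x)).sin.fun_neg.smul_const (innerSL ℝ a)).fderiv
  rw [InnerProductSpace.laplacian_eq_iteratedFDeriv_stdOrthonormalBasis]
  simp only [iteratedFDeriv_two_apply, h1, h2]
  rw [← (stdOrthonormalBasis ℝ E).sum_sq_inner_left a, Finset.sum_mul, ← Finset.sum_neg_distrib]
  refine Finset.sum_congr rfl fun i _ => ?_
  simp
  ring

theorem nondegenerate_innerₗ (E : Type*) [NormedAddCommGroup E] [InnerProductSpace ℝ E] :
    LinearMap.BilinForm.Nondegenerate (innerₗ E) :=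
  ⟨fun _ h => inner_self_eq_zero.mp (h _), fun _ h => inner_self_eq_zero.mp (h _)⟩

/-- The fundamental parallelepipeds of dual bases have reciprocal volumes. -/
theorem measureReal_fundamentalDomain_mul_of_inner_eq {ι E : Type*} [Fintype ι] [DecidableEq ι]
    [NormedAddCommGroup E] [InnerProductSpace ℝ E] [FiniteDimensional ℝ E] [MeasurableSpace E]
    [BorelSpace E] (b c : Basis ι ℝ E)
    (h : ∀ i j, inner ℝ (c i) (b j) = if j = i then (1 : ℝ) else 0) :
    volume.real (ZSpan.fundamentalDomain c) * volume.real (ZSpan.fundamentalDomain b) = 1 := by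
  let o : OrthonormalBasis ι ℝ E := (stdOrthonormalBasis ℝ E).reindex
    (Fintype.equivOfCardEq (by rw [Fintype.card_fin, finrank_eq_card_basis b]))
  have ho : volume.real (ZSpan.fundamentalDomain o.toBasis) = 1 := by
    rw [measureReal_congr (ZSpan.fundamentalDomain_ae_parallelepiped o.toBasis volume),
      OrthonormalBasis.coe_toBasis, measureReal_def, o.volume_parallelepiped, ENNReal.toReal_one]
  rw [ZSpan.measureReal_fundamentalDomain c volume o.toBasis,
    ZSpan.measureReal_fundamentalDomain b volume o.toBasis, ho, mul_one, mul_one, ← abs_mul,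
    Basis.det_apply, Basis.det_apply, ← Matrix.det_transpose, ← Matrix.det_mul]
  -- Parseval in `o` turns duality into a matrix identity, making the determinants reciprocal.
  have hmat : (o.toBasis.toMatrix c).transpose * o.toBasis.toMatrix b = 1 := by
    ext i j
    rw [Matrix.mul_apply, Matrix.one_apply]
    simp only [Matrix.transpose_apply, Basis.toMatrix_apply, OrthonormalBasis.coe_toBasis_repr_apply,
      o.repr_apply_apply]
    rw [Finset.sum_congr rfl fun k _ => by rw [real_inner_comm], o.sum_inner_mul_inner, h]
    simp only [eq_comm]
  rw [hmat, Matrix.det_one, abs_one]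

/-! ### Dual lattice, spectrum and isometry class -/

namespace FlatTorus

variable {n : ℕ}

/-- The dual lattice `{ξ | ∀ l ∈ L, ⟪ξ, l⟫ ∈ ℤ}`. -/
noncomputable def dualLattice (T : FlatTorus n) : Submodule ℤ (EuclideanSpace ℝ (Fin n)) :=
  LinearMap.BilinForm.dualSubmodule (innerₗ _) T.lattice

theorem mem_dualLattice {T : FlatTorus n} {ξ : EuclideanSpace ℝ (Fin n)} :
    ξ ∈ T.dualLattice ↔ ∀ l ∈ T.lattice, ∃ k : ℤ, (k : ℝ) = inner ℝ ξ l := by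
  simp only [dualLattice, LinearMap.BilinForm.mem_dualSubmodule, Submodule.mem_one]
  rfl

theorem exists_basis_dualLattice (T : FlatTorus n) :
    ∃ c : Basis (Fin n) ℝ (EuclideanSpace ℝ (Fin n)),
      T.dualLattice = Submodule.span ℤ (Set.range c) ∧
      volume.real (ZSpan.fundamentalDomain c) * T.vol = 1 := by
  have := T.discrete
  have := T.fullRank
  let b' := Module.Free.chooseBasis ℤ T.lattice
  let b₀ := b'.ofZLatticeBasis ℝ T.lattice
  have hcard : Fintype.card (Module.Free.ChooseBasisIndex ℤ T.lattice) = n := by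
    rw [← finrank_eq_card_basis b₀, finrank_euclideanSpace_fin]
  let b := (b'.reindex (Fintype.equivFinOfCardEq hcard))
  have hspan : Submodule.span ℤ (Set.range (b.ofZLatticeBasis ℝ T.lattice)) = T.lattice :=
    b.ofZLatticeBasis_span ℝ
  let hB := nondegenerate_innerₗ (EuclideanSpace ℝ (Fin n))
  refine ⟨LinearMap.BilinForm.dualBasis _ hB (b.ofZLatticeBasis ℝ T.lattice), ?_, ?_⟩
  · rw [dualLattice, ← LinearMap.BilinForm.dualSubmodule_span_of_basis, hspan]
  · rw [vol, ZLattice.covolume_eq_measure_fundamentalDomain T.lattice volume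
      (ZLattice.isAddFundamentalDomain b volume)]
    exact measureReal_fundamentalDomain_mul_of_inner_eq _ _ fun i j =>
      LinearMap.BilinForm.apply_dualBasis_left hB _ i j

/-- Biduality: the spectral data only control the dual lattice, from which the torus must be
recovered. -/
theorem mem_lattice_iff {T : FlatTorus n} {x : EuclideanSpace ℝ (Fin n)} :
    x ∈ T.lattice ↔ ∀ ξ ∈ T.dualLattice, ∃ k : ℤ, (k : ℝ) = inner ℝ x ξ := by
  have := T.discrete
  have := T.fullRank
  let b := Module.Free.chooseBasis ℤ T.lattice
  have h := LinearMap.BilinForm.dualSubmodule_dualSubmodule_of_basis (R := ℤ) (innerₗ _)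
    (nondegenerate_innerₗ (EuclideanSpace ℝ (Fin n))) ⟨fun x y => real_inner_comm y x⟩
    (b.ofZLatticeBasis ℝ T.lattice)
  rw [b.ofZLatticeBasis_span ℝ] at h
  rw [← h, LinearMap.BilinForm.mem_dualSubmodule]
  exact forall₂_congr fun ξ _ => Submodule.mem_one

/-- The plane wave `cos (2π⟪ξ, x⟫)` descends to the torus, as lattice translations shift its phase
by multiples of `2π`. -/
theorem isEigenvalue_of_mem_dualLattice {T : FlatTorus n} {ξ : EuclideanSpace ℝ (Fin n)}
    (hξ : ξ ∈ T.dualLattice) : T.IsEigenvalue ((2 * Real.pi * ‖ξ‖) ^ 2) := by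
  let f : T.Carrier → ℝ := fun z => Quotient.liftOn' z
    (fun x => Real.cos (inner ℝ ((2 * Real.pi) • ξ) x)) fun x y hxy => by
      obtain ⟨k, hk⟩ := mem_dualLattice.mp hξ (-x + y) (QuotientAddGroup.leftRel_apply.mp hxy)
      have h : inner ℝ ((2 * Real.pi) • ξ) y =
          inner ℝ ((2 * Real.pi) • ξ) x + k * (2 * Real.pi) := by
        rw [inner_add_right, inner_neg_right] at hk
        rw [real_inner_smul_left, real_inner_smul_left, hk]
        ring
      change Real.cos _ = Real.cos _
      rw [h, Real.cos_add_int_mul_two_pi]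
  have hf : (fun x => f (T.proj x)) = fun x => Real.cos (inner ℝ ((2 * Real.pi) • ξ) x) := rfl
  refine ⟨f, fun h0 => ?_, ?_, fun x => ?_⟩
  · have h1 := congrFun hf 0
    simp [h0] at h1
  · rw [SmoothFun, hf]
    exact Real.contDiff_cos.comp (contDiff_const.inner ℝ contDiff_id)
  · rw [congrFun hf x, hf, laplacian_cos_inner, norm_smul, neg_neg,
      Real.norm_of_nonneg (by positivity)]

theorem isometryClass_eq_of_map_eq {T T' : FlatTorus n}
    (φ : EuclideanSpace ℝ (Fin n) ≃ₗᵢ[ℝ] EuclideanSpace ℝ (Fin n))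
    (h : ∀ x, φ x ∈ T'.lattice ↔ x ∈ T.lattice) : T.isometryClass = T'.isometryClass := by
  have hmap : T.lattice.toAddSubgroup.map φ.toLinearEquiv.toAddEquiv.toAddMonoidHom =
      T'.lattice.toAddSubgroup := by
    ext y
    constructor
    · rintro ⟨x, hx, rfl⟩
      exact (h x).mpr hx
    · intro hy
      refine ⟨φ.symm y, (h _).mp ?_, φ.apply_symm_apply y⟩
      rwa [φ.apply_symm_apply]
  let e : T.Carrier ≃+ T'.Carrier :=
    QuotientAddGroup.congr _ _ φ.toLinearEquiv.toAddEquiv hmap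
  have he : ∀ x : EuclideanSpace ℝ (Fin n), e (QuotientAddGroup.mk x) = QuotientAddGroup.mk (φ x) :=
    fun x => rfl
  have hnorm : ∀ z, ‖e z‖ = ‖z‖ := by
    intro z
    induction z using QuotientAddGroup.induction_on with
    | H x =>
      -- The quotient norm is the distance to the lattice, which `φ` preserves.
      rw [he, QuotientAddGroup.norm_mk, QuotientAddGroup.norm_mk, ← hmap]
      exact infDist_image φ.isometry
  exact Quotient.sound ⟨⟨e.toEquiv, AddMonoidHomClass.isometry_of_norm e hnorm⟩⟩

/-- Tori whose dual lattices are generated by families with the same Gram matrix are isometric. -/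
theorem isometryClass_eq_of_inner_eq {T T' : FlatTorus n} {ι : Type*}
    {f f' : ι → EuclideanSpace ℝ (Fin n)}
    (hf : Submodule.span ℤ (Set.range f) = T.dualLattice)
    (hf' : Submodule.span ℤ (Set.range f') = T'.dualLattice)
    (h : ∀ i j, inner ℝ (f i) (f j) = inner ℝ (f' i) (f' j)) :
    T.isometryClass = T'.isometryClass := by
  obtain ⟨φ, hφ⟩ := exists_linearIsometryEquiv_of_inner_eq h
  have hmap : T.dualLattice.map φ.toLinearEquiv.toAddEquiv.toIntLinearEquiv.toLinearMap =
      T'.dualLattice := by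
    rw [← hf, ← hf', Submodule.map_span, ← Set.range_comp]
    congr 2
    exact funext hφ
  refine isometryClass_eq_of_map_eq φ fun x => ?_
  rw [mem_lattice_iff, mem_lattice_iff, ← hmap]
  constructor
  · intro hx ξ hξ
    rw [← φ.inner_map_map]
    exact hx (φ ξ) ⟨ξ, hξ, rfl⟩
  · rintro hx _ ⟨ξ, hξ, rfl⟩
    exact (hx ξ hξ).imp fun k hk => hk.trans (φ.inner_map_map x ξ).symm

/-- A positive lower bound for the fundamental tone bounds every nonzero eigenvalue from below. -/
theorem le_of_le_fundamentalTone {T : FlatTorus n} {lam mu : ℝ} (hlam : 0 < lam)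
    (h : lam ≤ T.fundamentalTone) (hmu : T.IsEigenvalue mu) (h0 : mu ≠ 0) : lam ≤ mu := by
  refine h.trans (csInf_le (by_contra fun hb => ?_) ⟨hmu, h0⟩)
  -- The infimum of a set unbounded below is `0` by convention, contradicting `0 < lam`.
  rw [fundamentalTone, Real.sInf_of_not_bddBelow hb] at h
  exact absurd h (not_le.mpr hlam)

theorem norm_le_of_mem_dualLattice {T : FlatTorus n} {lam : ℝ} (hlam : 0 < lam)
    (h : lam ≤ T.fundamentalTone) {ξ : EuclideanSpace ℝ (Fin n)} (hξ : ξ ∈ T.dualLattice)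
    (h0 : ξ ≠ 0) : Real.sqrt lam / (2 * Real.pi) ≤ ‖ξ‖ := by
  have hpos : 0 < 2 * Real.pi * ‖ξ‖ := mul_pos Real.two_pi_pos (norm_pos_iff.mpr h0)
  have h1 := le_of_le_fundamentalTone hlam h (isEigenvalue_of_mem_dualLattice hξ)
    (pow_ne_zero 2 hpos.ne')
  rw [div_le_iff₀' Real.two_pi_pos]
  exact Real.sqrt_le_iff.mpr ⟨hpos.le, h1⟩

/-- The packing ratio of balls of radius half the minimal length of the dual lattice. -/
noncomputable def packingRatio (n : ℕ) (s : ℝ) : ℝ :=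
  (4 * Real.pi) ^ n / (volume.real (ball (0 : EuclideanSpace ℝ (Fin n)) 1) * s)

theorem packingRatio_nonneg (n : ℕ) {s : ℝ} (hs : 0 < s) : 0 ≤ packingRatio n s := by
  have := Real.pi_pos
  unfold packingRatio
  positivity

/-- This matches `v⁻¹`, the bound on the dual covolume, with the packing hypothesis; the powers of
`lam` cancel, so the ratio depends only on `n` and `λ^{n/2}v`. -/
theorem packingRatio_mul_volume_ball (hn : 0 < n) {lam v : ℝ} (hlam : 0 < lam) (hv : 0 < v) :
    packingRatio n (lam ^ ((n : ℝ) / 2) * v) *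
      volume.real (ball (0 : EuclideanSpace ℝ (Fin n)) (Real.sqrt lam / (2 * Real.pi) / 2)) =
      v⁻¹ := by
  have : NeZero n := ⟨hn.ne'⟩
  have hpi := Real.pi_pos
  have hω : 0 < volume.real (ball (0 : EuclideanSpace ℝ (Fin n)) 1) :=
    ENNReal.toReal_pos (measure_ball_pos _ _ one_pos).ne' measure_ball_lt_top.ne
  have hsq : lam ^ ((n : ℝ) / 2) = Real.sqrt lam ^ n := by
    rw [Real.sqrt_eq_rpow, ← Real.rpow_mul_natCast hlam.le]
    ring_nf
  have hr : 0 < Real.sqrt lam := Real.sqrt_pos.mpr hlam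
  have hball : volume.real (ball (0 : EuclideanSpace ℝ (Fin n))
      (Real.sqrt lam / (2 * Real.pi) / 2)) = (Real.sqrt lam / (4 * Real.pi)) ^ n *
        volume.real (ball (0 : EuclideanSpace ℝ (Fin n)) 1) := by
    rw [measureReal_def, Measure.addHaar_ball _ _ (by positivity), ENNReal.toReal_mul,
      ENNReal.toReal_ofReal (by positivity), finrank_euclideanSpace_fin, measureReal_def]
    ring
  rw [hball, packingRatio, hsq, div_pow]
  field_simp

/-- The dual lattice is generated by vectors of controlled length. -/
theorem span_dualLattice_norm_le (hn : 0 < n) {T : FlatTorus n} {lam v : ℝ} (hlam : 0 < lam)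
    (hv : 0 < v) (hT : lam ≤ T.fundamentalTone) (hvol : v ≤ T.vol) :
    Submodule.span ℤ {ξ | ξ ∈ T.dualLattice ∧ ‖ξ‖ ≤ Real.sqrt lam / (2 * Real.pi) *
      (2 * packingRatio n (lam ^ ((n : ℝ) / 2) * v) + 1)} = T.dualLattice := by
  have hm : 0 < Real.sqrt lam / (2 * Real.pi) :=
    div_pos (Real.sqrt_pos.mpr hlam) Real.two_pi_pos
  have hq := packingRatio_nonneg n (mul_pos (Real.rpow_pos_of_pos hlam ((n : ℝ) / 2)) hv)
  have hqv := packingRatio_mul_volume_ball hn hlam hv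
  have hmin := fun ξ (hξ : ξ ∈ T.dualLattice) => norm_le_of_mem_dualLattice hlam hT hξ
  set m := Real.sqrt lam / (2 * Real.pi)
  set q := packingRatio n (lam ^ ((n : ℝ) / 2) * v)
  obtain ⟨c, hc, hcv⟩ := T.exists_basis_dualLattice
  have hF : volume (ZSpan.fundamentalDomain c) ≤
      ENNReal.ofReal q * volume (ball (0 : EuclideanSpace ℝ (Fin n)) (m / 2)) := by
    rw [← ENNReal.ofReal_toReal (measure_ball_lt_top (μ := volume)).ne, ← measureReal_def,
      ← ENNReal.ofReal_mul hq, hqv,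
      ← ENNReal.ofReal_toReal (ZSpan.fundamentalDomain_isBounded c).measure_lt_top.ne,
      ← measureReal_def, eq_inv_of_mul_eq_one_left hcv]
    exact ENNReal.ofReal_le_ofReal (inv_anti₀ hv hvol)
  rw [hc] at hmin ⊢
  have hcov := IsAddFundamentalDomain.exists_mem_norm_sub_le
    (ZSpan.isAddFundamentalDomain c volume) hm hq hmin hF
  rw [show m * (2 * q + 1) = 2 * (m * q) + m by ring]
  exact Submodule.span_int_setOf_norm_le_eq hm hcov

end FlatTorus

/-! ### Finiteness of the isometry classes -/

theorem lemma2p8 (n : ℕ) (hn : 0 < n) :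
    ∃ A : ℝ → ℝ, (∀ s : ℝ, 0 < s → 1 < A s) ∧
      ∀ lam v : ℝ, 0 < lam → 0 < v →
        ∀ E : Set ℝ, E.Finite →
          E ⊆ Set.Icc lam (A (lam ^ ((n : ℝ) / 2) * v) * lam) →
          Set.Finite (FlatTorus.isometryClass '' {T : FlatTorus n |
            lam ≤ T.fundamentalTone ∧ v ≤ T.vol ∧
            T.eigenvalueSet ∩ Set.Icc lam (A (lam ^ ((n : ℝ) / 2) * v) * lam) ⊆ E}) := by
  -- Since `2πm = √λ`, this is the factor for which `(2π · 2R)² = Aλ`.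
  refine ⟨fun s => 4 * (2 * FlatTorus.packingRatio n s + 1) ^ 2, fun s hs => ?_, ?_⟩
  · nlinarith [FlatTorus.packingRatio_nonneg n hs]
  intro lam v hlam hv E hE _
  have hq := FlatTorus.packingRatio_nonneg n (mul_pos (Real.rpow_pos_of_pos hlam ((n : ℝ) / 2)) hv)
  have hgen := fun T hT hvol =>
    FlatTorus.span_dualLattice_norm_le (n := n) (T := T) hn hlam hv hT hvol
  beta_reduce
  set q := FlatTorus.packingRatio n (lam ^ ((n : ℝ) / 2) * v)
  set X : Set (FlatTorus n) := {T | lam ≤ T.fundamentalTone ∧ v ≤ T.vol ∧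
    T.eigenvalueSet ∩ Set.Icc lam (4 * (2 * q + 1) ^ 2 * lam) ⊆ E}
  set m := Real.sqrt lam / (2 * Real.pi) with hm_def
  have hm : 0 < m := div_pos (Real.sqrt_pos.mpr hlam) Real.two_pi_pos
  set R := m * (2 * q + 1)
  obtain ⟨t, ht⟩ := exists_finset_forall_separated_eq_range
    (E := EuclideanSpace ℝ (Fin n)) R hm
  have hfam : ∀ T ∈ X, ∃ f : t → EuclideanSpace ℝ (Fin n),
      Set.range f = {ξ | ξ ∈ T.dualLattice ∧ ‖ξ‖ ≤ R} := by
    intro T hT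
    refine ht _ ⟨0, T.dualLattice.zero_mem, by rw [norm_zero]; positivity⟩
      (fun ξ hξ => mem_closedBall_zero_iff.mpr hξ.2) fun x hx y hy hxy => ?_
    rw [dist_eq_norm]
    exact FlatTorus.norm_le_of_mem_dualLattice hlam hT.1 (sub_mem hx.1 hy.1) (sub_ne_zero.mpr hxy)
  choose! f hf using hfam
  -- Possible squared lengths; `0` is added for the zero vector, whose eigenvalue lies below the
  -- window.
  let D : Set ℝ := (fun e => e / (2 * Real.pi) ^ 2) '' insert 0 E
  have hD : D.Finite := (hE.insert 0).image _
  have hnorm : ∀ T ∈ X, ∀ ξ ∈ T.dualLattice, ‖ξ‖ ≤ 2 * R → ‖ξ‖ ^ 2 ∈ D := by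
    intro T hT ξ hξ hξR
    refine ⟨(2 * Real.pi * ‖ξ‖) ^ 2, ?_, ?_⟩
    · rcases eq_or_ne ξ 0 with rfl | h0
      · simp
      have heig := FlatTorus.isEigenvalue_of_mem_dualLattice hξ
      have hne : (2 * Real.pi * ‖ξ‖) ^ 2 ≠ 0 :=
        pow_ne_zero 2 (mul_ne_zero Real.two_pi_pos.ne' (norm_ne_zero_iff.mpr h0))
      refine Or.inr (hT.2.2 ⟨heig, FlatTorus.le_of_le_fundamentalTone hlam hT.1 heig hne, ?_⟩)
      calc (2 * Real.pi * ‖ξ‖) ^ 2 ≤ (2 * Real.pi * (2 * R)) ^ 2 := by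
            have := Real.pi_pos
            gcongr
        _ = 4 * (2 * q + 1) ^ 2 * Real.sqrt lam ^ 2 := by
            simp only [R, hm_def]
            field_simp
            ring
        _ = _ := by rw [Real.sq_sqrt hlam.le]
    · have := Real.pi_pos
      field_simp
  -- Polarization: `⟪x, y⟫ = (‖x + y‖² - ‖x‖² - ‖y‖²) / 2`.
  let G : Set ℝ := (fun p : ℝ × ℝ × ℝ => (p.1 - p.2.1 - p.2.2) / 2) '' (D ×ˢ D ×ˢ D)
  have hG : G.Finite := (hD.prod (hD.prod hD)).image _
  let g : FlatTorus n → t → t → ℝ := fun T i j => inner ℝ (f T i) (f T j)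
  have hgX : (g '' X).Finite := by
    refine (Set.Finite.pi' fun _ => Set.Finite.pi' fun _ => hG).subset ?_
    rintro _ ⟨T, hT, rfl⟩ i j
    have hi : f T i ∈ {ξ | ξ ∈ T.dualLattice ∧ ‖ξ‖ ≤ R} := hf T hT ▸ Set.mem_range_self i
    have hj : f T j ∈ {ξ | ξ ∈ T.dualLattice ∧ ‖ξ‖ ≤ R} := hf T hT ▸ Set.mem_range_self j
    have hR : 0 ≤ R := (norm_nonneg _).trans hi.2
    refine ⟨⟨‖f T i + f T j‖ ^ 2, ‖f T i‖ ^ 2, ‖f T j‖ ^ 2⟩, ⟨hnorm T hT _ (add_mem hi.1 hj.1) ?_,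
      hnorm T hT _ hi.1 (by linarith [hi.2]), hnorm T hT _ hj.1 (by linarith [hj.2])⟩, ?_⟩
    · linarith [norm_add_le (f T i) (f T j), hi.2, hj.2]
    · simp only [g, norm_add_sq_real]
      ring
  have hclass : ∀ T ∈ X, ∀ T' ∈ X, g T = g T' → T.isometryClass = T'.isometryClass := by
    intro T hT T' hT' h
    refine FlatTorus.isometryClass_eq_of_inner_eq (f := f T) (f' := f T') ?_ ?_
      fun i j => congrFun (congrFun h i) j
    · rw [hf T hT, hgen T hT.1 hT.2.1]
    · rw [hf T' hT', hgen T' hT'.1 hT'.2.1]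
  rcases X.eq_empty_or_nonempty with hX | ⟨T₀, -⟩
  · simp [hX]
  have : Nonempty (FlatTorus n) := ⟨T₀⟩
  have hpick : ∀ y ∈ g '' X, ∃ T ∈ X, g T = y := fun y hy => hy
  choose! r hrX hr using hpick
  refine (hgX.image fun y => (r y).isometryClass).subset ?_
  rintro _ ⟨T, hT, rfl⟩
  have hy := Set.mem_image_of_mem g hT
  exact ⟨g T, hy, hclass _ (hrX _ hy) T hT (hr _ hy)⟩
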